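/- Let $D$ and $T$ be disjoint finite sets (the states of Despot and of Tribune), $\Sigma$ a finite set of actions, and $\Delta\subseteq (T\times\Sigma\times D)\cup(D\times\Sigma\times T)$ a transition relation that is non-blocking: every $d\in D$ has some transition $(d,a,t)\in\Delta$ and every $t\in T$ some transition $(t,b,d)\in\Delta$. A strategy of Despot is a function $\sigma:(D\cdot\Sigma\cdot T\cdot\Sigma)^*\cdot D\to\Sigma$ such that the action $a=\sigma(h\,d)$ always has some transition $(d,a,\cdot)\in\Delta$; a strategy of Tribune is a function $\tau:(D\cdot\Sigma\cdot T\cdot\Sigma)^*\cdot D\cdot\Sigma\cdot T\to\Sigma$ such that the action $b=\tau(h\,d\,a\,t)$ always has some transition $(t,b,\cdot)\in\Delta$. A strategy is positional if its value depends only on the last state of its argument. For strategies $\sigma,\tau$ let $L(\sigma,\tau)$ be the set of all infinite words $d_0a_0t_0b_0d_1a_1t_1b_1\cdots$ (with any initial state $d_0\in D$) such that, for all $i\ge 0$, $(d_i,a_i,t_i)\in\Delta$, $(t_i,b_i,d_{i+1})\in\Delta$, $a_i=\sigma(d_0a_0t_0b_0\cdots t_{i-1}b_{i-1}d_i)$ and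 $b_i=\tau(d_0a_0t_0b_0\cdots d_ia_it_i)$. The payoff, which Despot minimizes and Tribune maximizes, is $$P(\sigma,\tau)=\limsup_{n\to\infty}\bigl|\mathrm{pref}_{4n}(L(\sigma,\tau))\bigr|^{1/n},$$ where $\mathrm{pref}_{4n}(L)$ is the set of prefixes of length $4n$ of the words in $L$. **Theorem.** Every such game (entropy game) is determined, and Despot and Tribune possess positional optimal strategies. That is, there is a real number $V\ge 0$ with $$\inf_\sigma\sup_\tau P(\sigma,\tau)=V=\sup_\tau\inf_\sigma P(\sigma,\tau),$$ where $\sigma$ and $\tau$ range over all strategies, and there are positional strategies $\sigma^*$ of Despot and $\tau^*$ of Tribune such that $P(\sigma^*,\tau)\le V$ for every strategy $\tau$ of Tribune and $P(\sigma,\tau^*)\ge V$ for every strategy $\sigma$ of Despot. -/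

import Mathlib

open Filter
open scoped ENNReal NNReal

namespace EntropyGame

/-- An arena with Despot's states `D`, Tribune's states `T` (disjoint, being separate types) and
actions `Act`. The transition relation, a subset of `T × Act × D ∪ D × Act × T`, is given by its two
parts. The arena is non-blocking: every state has at least one outgoing transition. -/
structure Arena (D T Act : Type*) where
  despotTrans : D → Act → T → Prop
  tribuneTrans : T → Act → D → Prop
  despot_nonblocking : ∀ d, ∃ a t, despotTrans d a t
  tribune_nonblocking : ∀ t, ∃ b d, tribuneTrans t b d

/-- One turn of the game: four consecutive letters `d a t b` of a play. -/
@[ext]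
structure Turn (D T Act : Type*) where
  despotState : D
  despotAction : Act
  tribuneState : T
  tribuneAction : Act

variable {D T Act : Type*}

/-- A strategy of Despot: a function from `(D · Act · T · Act)* · D` to `Act`, which always chooses
an action with a corresponding transition. -/
structure DespotStrategy (A : Arena D T Act) where
  act : List (Turn D T Act) → D → Act
  legal : ∀ h d, ∃ t, A.despotTrans d (act h d) t

/-- A strategy of Tribune: a function from `(D · Act · T · Act)* · D · Act · T` to `Act`, which
always chooses an action with a corresponding transition. -/
structure TribuneStrategy (A : Arena D T Act) where
  act : List (Turn D T Act) → D → Act → T → Act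
  legal : ∀ h d a t, ∃ d', A.tribuneTrans t (act h d a t) d'

/-- The choice of Despot depends only on the current state. -/
def DespotStrategy.IsPositional {A : Arena D T Act} (σ : DespotStrategy A) : Prop :=
  ∃ f : D → Act, ∀ h d, σ.act h d = f d

/-- The choice of Tribune depends only on the current state. -/
def TribuneStrategy.IsPositional {A : Arena D T Act} (τ : TribuneStrategy A) : Prop :=
  ∃ f : T → Act, ∀ h d a t, τ.act h d a t = f t

/-- The word formed by the first `n` turns (that is, the first `4 n` letters) of an infinite word. -/
def initialTurns (π : ℕ → Turn D T Act) (n : ℕ) : List (Turn D T Act) :=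
  (List.range n).map π

/-- An infinite word is a play if it respects the transition relation. -/
def Arena.IsPlay (A : Arena D T Act) (π : ℕ → Turn D T Act) : Prop :=
  ∀ n, A.despotTrans (π n).despotState (π n).despotAction (π n).tribuneState ∧
    A.tribuneTrans (π n).tribuneState (π n).tribuneAction (π (n + 1)).despotState

/-- All of Despot's actions in the word are those dictated by `σ`. -/
def DespotStrategy.Compatible {A : Arena D T Act} (σ : DespotStrategy A)
    (π : ℕ → Turn D T Act) : Prop :=
  ∀ n, (π n).despotAction = σ.act (initialTurns π n) (π n).despotState

/-- All of Tribune's actions in the word are those dictated by `τ`. -/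
def TribuneStrategy.Compatible {A : Arena D T Act} (τ : TribuneStrategy A)
    (π : ℕ → Turn D T Act) : Prop :=
  ∀ n, (π n).tribuneAction =
    τ.act (initialTurns π n) (π n).despotState (π n).despotAction (π n).tribuneState

/-- The `ω`-language of all infinite plays, from any initial state in `D`, compatible with both
strategies. -/
def playLanguage {A : Arena D T Act} (σ : DespotStrategy A) (τ : TribuneStrategy A) :
    Set (ℕ → Turn D T Act) :=
  {π | A.IsPlay π ∧ σ.Compatible π ∧ τ.Compatible π}

/-- The set of prefixes consisting of `n` turns (`4 n` letters) of the words of a language. -/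
def turnPrefixes (L : Set (ℕ → Turn D T Act)) (n : ℕ) : Set (List (Turn D T Act)) :=
  (fun π => initialTurns π n) '' L

/-- The amount that Despot pays to Tribune: the growth rate, with respect to the number of turns, of
the number of plays available to People. -/
noncomputable def payoff {A : Arena D T Act} (σ : DespotStrategy A) (τ : TribuneStrategy A) :
    ℝ≥0∞ :=
  limsup (fun n : ℕ => ((turnPrefixes (playLanguage σ τ) n).ncard : ℝ≥0∞) ^ (1 / (n : ℝ))) atTop

/-- The game is determined with value `V`: the least payoff that Despot can guarantee not to exceed
and the greatest payoff that Tribune can guarantee to reach, as infimum and supremum over all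
strategies, both equal `V`. -/
def Arena.IsDeterminedWithValue (A : Arena D T Act) (V : ℝ≥0∞) : Prop :=
  (⨅ σ : DespotStrategy A, ⨆ τ : TribuneStrategy A, payoff σ τ) = V ∧
    (⨆ τ : TribuneStrategy A, ⨅ σ : DespotStrategy A, payoff σ τ) = V

/-- With `σ`, Despot never pays more than `V`, against any strategy of Tribune. -/
def DespotStrategy.Guarantees {A : Arena D T Act} (σ : DespotStrategy A) (V : ℝ≥0∞) : Prop :=
  ∀ τ : TribuneStrategy A, payoff σ τ ≤ V

/-- With `τ`, Tribune never receives less than `V`, against any strategy of Despot. -/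
def TribuneStrategy.Guarantees {A : Arena D T Act} (τ : TribuneStrategy A) (V : ℝ≥0∞) : Prop :=
  ∀ σ : DespotStrategy A, V ≤ payoff σ τ

end EntropyGame

/-! One turn acts on weights of Despot's states by `F x d = min_a ∑_t max_b ∑_d' x d'`, a monotone,
continuous, positively homogeneous map. Were `F u = l u` with `u > 0`, optimal actions for `u` would
be positional and optimal in the game: weigh each reachable position by `u` of its current state. In
one turn the total weight is multiplied by at most `l` if Despot plays optimally for `u`, and by at
least `l` if Tribune does, whatever the opponent remembers. Up to constant factors the total weight
counts the prefixes, so the growth rate is `l`.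

`F` may have no positive eigenvector, but `F + ε · mass` has one
(`exists_pos_eigenvector_add_mass`). As `ε → 0`, some pair of positional choices recurs by
finiteness, and along a subsequence `l → V` and `u → v`. The limit `v` may vanish somewhere, so the
two bounds are treated differently: the lower one needs only `v ≥ 0` and is proved for the limit,
while the upper one is proved for each positive `u` and only then does `l` tend to `V`. -/

namespace EntropyGame

open Finset Topology

/-! ### Positive eigenvectors of perturbed monotone maps -/

section Perron

variable {ι : Type*} [Fintype ι]

/-- A continuous, monotone, positively homogeneous map, perturbed by a small multiple of the total
mass, has a positive eigenvector. -/
theorem exists_pos_eigenvector_add_mass [Nonempty ι] (F : (ι → ℝ) → ι → ℝ) (hcont : Continuous F)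
    (hmono : Monotone F) (hhom : ∀ c : ℝ, 0 ≤ c → ∀ x, F (c • x) = c • F x) {ε : ℝ} (hε : 0 < ε) :
    ∃ (l : ℝ) (u : ι → ℝ), 0 ≤ l ∧ (∀ i, 0 < u i) ∧ ∑ i, u i = 1 ∧
      ∀ i, F u i + ε = l * u i := by
  have hF0 : F 0 = 0 := by simpa using hhom 0 le_rfl 0
  have hpos : ∀ x, 0 ≤ x → 0 ≤ F x := fun x hx => by simpa [hF0] using hmono hx
  obtain ⟨v, hv⟩ : (stdSimplex ℝ ι ∩ {x | ∀ i, 0 < x i}).Nonempty := by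
    have hc : (0 : ℝ) < Fintype.card ι := by exact_mod_cast Fintype.card_pos
    refine ⟨fun _ => (Fintype.card ι : ℝ)⁻¹, ⟨fun _ => by positivity, ?_⟩, fun _ => by positivity⟩
    simp [hc.ne']
  obtain ⟨C, hC⟩ : ∃ C : ℝ, ∀ i, (F v i + ε) / v i ≤ C :=
    (Set.finite_range fun i => (F v i + ε) / v i).bddAbove.imp fun C h i => h ⟨i, rfl⟩
  have hCpos : 0 ≤ C := by
    obtain ⟨i⟩ := ‹Nonempty ι›
    exact (div_nonneg (add_nonneg (hpos v hv.1.1 i) hε.le) (hv.2 i).le).trans (hC i)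
  -- The eigenvalue is found as the least `l` admitting a normalized `u` with `F u + ε ≤ l u`. The
  -- uniform vector `v` shows that `l = C` is admissible, which confines the search to a compact
  -- set.
  let K : Set (ℝ × (ι → ℝ)) :=
    (Set.Icc 0 C ×ˢ stdSimplex ℝ ι) ∩ {p | ∀ i, F p.2 i + ε ≤ p.1 * p.2 i}
  have hK : IsCompact K := by
    refine (isCompact_Icc.prod (isCompact_stdSimplex ℝ ι)).inter_right ?_
    simp only [Set.ofPred_forall]
    refine isClosed_iInter fun i => isClosed_le ?_ ?_ <;> fun_prop
  have hKne : K.Nonempty :=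
    ⟨(C, v), ⟨⟨hCpos, le_rfl⟩, hv.1⟩, fun i => (div_le_iff₀ (hv.2 i)).1 (hC i)⟩
  obtain ⟨⟨l, u⟩, ⟨⟨⟨hl0, hlC⟩, hu⟩, hle⟩, hmin⟩ :=
    hK.exists_isMinOn hKne continuous_fst.continuousOn
  simp only at hl0 hlC hu hle
  have hupos : ∀ i, 0 < u i := fun i => by
    have h1 := hle i
    have h2 := hpos u hu.1 i
    simp only [Pi.zero_apply] at h2
    exact pos_of_mul_pos_right (by linarith : 0 < l * u i) hl0
  refine ⟨l, u, hl0, hupos, hu.2, fun i => le_antisymm (hle i) (not_lt.1 fun hlt => ?_)⟩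
  classical
  -- If the inequality is strict at `i`, lower `u i` by a small `δ`. By monotonicity `F` does not
  -- grow, and the perturbation `ε · mass` drops by `ε δ`, so all the inequalities become strict.
  -- Then `l` can be decreased too; rescaling to mass `1` contradicts minimality.
  obtain ⟨δ, hδ0, hδu, hδ1, hδg⟩ : ∃ δ > 0, δ < u i ∧ δ < 1 ∧ F u i + ε < l * (u i - δ) := by
    have h1 : ∀ᶠ δ in 𝓝[>] (0 : ℝ), F u i + ε < l * (u i - δ) := by
      refine Tendsto.eventually_const_lt (u := F u i + ε) (v := l * (u i - 0)) (by simpa) ?_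
      exact (Continuous.tendsto (by fun_prop) 0).mono_left nhdsWithin_le_nhds
    have h2 : ∀ᶠ δ in 𝓝[>] (0 : ℝ), δ < u i := nhdsWithin_le_nhds (eventually_lt_nhds (hupos i))
    have h3 : ∀ᶠ δ in 𝓝[>] (0 : ℝ), δ < 1 := nhdsWithin_le_nhds (eventually_lt_nhds one_pos)
    obtain ⟨δ, h⟩ := (h1.and (h2.and (h3.and self_mem_nhdsWithin))).exists
    exact ⟨δ, h.2.2.2, h.2.1, h.2.2.1, h.1⟩
  let x : ι → ℝ := Function.update u i (u i - δ)
  have hxu : x ≤ u := by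
    intro j
    by_cases hj : j = i
    · subst hj; simp [x, hδ0.le]
    · simp [x, hj]
  have hxpos : ∀ j, 0 < x j := by
    intro j
    by_cases hj : j = i
    · subst hj; simpa [x] using hδu
    · simpa [x, hj] using hupos j
  have hxsum : ∑ j, x j = 1 - δ := by
    have h := hu.2
    rw [← Finset.add_sum_erase _ _ (mem_univ i)] at h ⊢
    have : ∑ j ∈ univ.erase i, x j = ∑ j ∈ univ.erase i, u j :=
      Finset.sum_congr rfl fun j hj => by simp [x, Finset.ne_of_mem_erase hj]
    rw [this]
    simp only [x, Function.update_self]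
    linarith
  have hstrict : ∀ j, F x j + ε * (1 - δ) < l * x j := by
    intro j
    have h1 := hmono hxu j
    have h2 : 0 < ε * δ := mul_pos hε hδ0
    by_cases hj : j = i
    · subst hj
      simp only [x, Function.update_self] at h1 ⊢
      linarith
    · have h3 := hle j
      have h4 : x j = u j := by simp [x, hj]
      rw [h4]
      linarith
  obtain ⟨l', hl'l, hl'⟩ : ∃ l' < l, ∀ j, F x j + ε * (1 - δ) < l' * x j := by
    have h : ∀ᶠ l' in 𝓝[<] l, ∀ j, F x j + ε * (1 - δ) < l' * x j :=
      eventually_all.2 fun j => Tendsto.eventually_const_lt (hstrict j)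
        ((Continuous.tendsto (by fun_prop) l).mono_left nhdsWithin_le_nhds)
    obtain ⟨l', h1, h2⟩ := (h.and self_mem_nhdsWithin).exists
    exact ⟨l', h2, h1⟩
  have hs : 0 < 1 - δ := by linarith
  have hl'0 : 0 ≤ l' := by
    have h1 := hl' i
    have h2 := hpos x (fun j => (hxpos j).le) i
    simp only [Pi.zero_apply] at h2
    have h3 : 0 < ε * (1 - δ) := mul_pos hε hs
    exact (pos_of_mul_pos_left (by linarith : 0 < l' * x i) (hxpos i).le).le
  refine hl'l.not_ge (hmin (a := (l', (1 - δ)⁻¹ • x))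
    ⟨⟨⟨hl'0, hl'l.le.trans hlC⟩, fun j => ?_, ?_⟩, fun j => ?_⟩)
  · exact mul_nonneg (inv_nonneg.2 hs.le) (hxpos j).le
  · simp [← Finset.mul_sum, hxsum, hs.ne']
  · simp only [hhom _ (inv_nonneg.2 hs.le), Pi.smul_apply, smul_eq_mul]
    have h := mul_le_mul_of_nonneg_left (hl' j).le (inv_nonneg.2 hs.le)
    calc _ = (1 - δ)⁻¹ * (F x j + ε * (1 - δ)) := by field_simp
      _ ≤ _ := h
      _ = _ := by ring

end Perron

/-! ### The one-turn min-max operator -/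

section Operator

variable {D T Act : Type*} (A : Arena D T Act)

/-- `a` is an action available to Despot in state `d`. -/
def Arena.DespotLegal (d : D) (a : Act) : Prop := ∃ t, A.despotTrans d a t

/-- `b` is an action available to Tribune in state `t`. -/
def Arena.TribuneLegal (t : T) (b : Act) : Prop := ∃ d, A.tribuneTrans t b d

open Classical in
/-- The total weight of the successors of `t` under the action `b`. -/
noncomputable def Arena.tribuneWeight [Fintype D] (x : D → ℝ) (t : T) (b : Act) : ℝ :=
  ∑ d with A.tribuneTrans t b d, x d

open Classical in
/-- The total weight of the successors of `d` under the action `a`. -/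
noncomputable def Arena.despotWeight [Fintype T] (y : T → ℝ) (d : D) (a : Act) : ℝ :=
  ∑ t with A.despotTrans d a t, y t

open Classical in
/-- The actions available to Despot in state `d`. -/
noncomputable def Arena.despotActions [Fintype Act] (d : D) : Finset Act := {a | A.DespotLegal d a}

open Classical in
/-- The actions available to Tribune in state `t`. -/
noncomputable def Arena.tribuneActions [Fintype Act] (t : T) : Finset Act := {b | A.TribuneLegal t b}

theorem Arena.despotActions_nonempty [Fintype Act] (d : D) : (A.despotActions d).Nonempty := by
  obtain ⟨a, t, h⟩ := A.despot_nonblocking d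
  exact ⟨a, by simpa [Arena.despotActions] using ⟨t, h⟩⟩

theorem Arena.tribuneActions_nonempty [Fintype Act] (t : T) : (A.tribuneActions t).Nonempty := by
  obtain ⟨b, d, h⟩ := A.tribune_nonblocking t
  exact ⟨b, by simpa [Arena.tribuneActions] using ⟨d, h⟩⟩

theorem Arena.tribuneWeight_mono [Fintype D] {x y : D → ℝ} (h : x ≤ y) (t : T) (b : Act) :
    A.tribuneWeight x t b ≤ A.tribuneWeight y t b :=
  Finset.sum_le_sum fun d _ => h d

theorem Arena.despotWeight_mono [Fintype T] {x y : T → ℝ} (h : x ≤ y) (d : D) (a : Act) :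
    A.despotWeight x d a ≤ A.despotWeight y d a :=
  Finset.sum_le_sum fun t _ => h t

variable [Fintype D] [Fintype Act]

/-- The best weight that Tribune can obtain from `t` in one move. -/
noncomputable def Arena.tribuneBest (x : D → ℝ) (t : T) : ℝ :=
  (A.tribuneActions t).sup' (A.tribuneActions_nonempty t) (A.tribuneWeight x t)

theorem Arena.tribuneBest_mono : Monotone A.tribuneBest := fun _ _ h t =>
  Finset.sup'_mono_fun fun b _ => A.tribuneWeight_mono h t b

theorem Arena.continuous_tribuneBest : Continuous A.tribuneBest := by
  refine continuous_pi fun t => ?_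
  unfold Arena.tribuneBest
  refine Continuous.finset_sup'_apply _ fun b _ => ?_
  unfold Arena.tribuneWeight
  fun_prop

theorem Arena.tribuneBest_smul (c : ℝ) (hc : 0 ≤ c) (x : D → ℝ) :
    A.tribuneBest (c • x) = c • A.tribuneBest x := by
  funext t
  have h : A.tribuneWeight (c • x) t = fun b => c * A.tribuneWeight x t b := by
    funext b
    simp [Arena.tribuneWeight, Finset.mul_sum]
  simp only [Arena.tribuneBest, Pi.smul_apply, smul_eq_mul, Finset.mul₀_sup' hc, h]

variable [Fintype T]

/-- The one-turn operator of the game. -/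
noncomputable def Arena.turnOperator (x : D → ℝ) (d : D) : ℝ :=
  (A.despotActions d).inf' (A.despotActions_nonempty d) (A.despotWeight (A.tribuneBest x) d)

theorem Arena.turnOperator_mono : Monotone A.turnOperator := fun _ _ h d =>
  Finset.inf'_mono_fun fun a _ => A.despotWeight_mono (A.tribuneBest_mono h) d a

theorem Arena.continuous_turnOperator : Continuous A.turnOperator := by
  refine continuous_pi fun d => ?_
  unfold Arena.turnOperator
  refine Continuous.finset_inf'_apply _ fun b _ => ?_
  unfold Arena.despotWeight
  have := A.continuous_tribuneBest
  fun_prop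

theorem Arena.turnOperator_smul (c : ℝ) (hc : 0 ≤ c) (x : D → ℝ) :
    A.turnOperator (c • x) = c • A.turnOperator x := by
  funext d
  have h : A.despotWeight (c • A.tribuneBest x) d =
      fun a => c * A.despotWeight (A.tribuneBest x) d a := by
    funext a
    simp [Arena.despotWeight, Finset.mul_sum]
  rw [Arena.turnOperator, A.tribuneBest_smul c hc, h]
  exact (Finset.apply_inf'_eq_inf'_comp (A.despotActions_nonempty d) (fun z => c * z)
    fun p q => (monotone_mul_left_of_nonneg hc).map_min).symm

/-- For every perturbation there are a positive weight on Despot's states and positional choices of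
both players which are optimal, up to the perturbation, for this weight. -/
theorem Arena.exists_approx_equilibrium [Nonempty D] {ε : ℝ} (hε : 0 < ε) :
    ∃ (l : ℝ) (u : D → ℝ) (f : D → Act) (g : T → Act),
      l ∈ Set.Icc 0 (Fintype.card T * Fintype.card D + ε * Fintype.card D) ∧
      (∀ d, 0 < u d) ∧ ∑ d, u d = 1 ∧
      (∀ d, A.DespotLegal d (f d)) ∧ (∀ t, A.TribuneLegal t (g t)) ∧
      (∀ d (b : T → Act), (∀ t, A.TribuneLegal t (b t)) →
        A.despotWeight (fun t => A.tribuneWeight u t (b t)) d (f d) ≤ l * u d) ∧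
      ∀ d a, A.DespotLegal d a →
        l * u d ≤ A.despotWeight (fun t => A.tribuneWeight u t (g t)) d a + ε := by
  obtain ⟨l, u, hl, hu, hsum, heq⟩ := exists_pos_eigenvector_add_mass A.turnOperator
    A.continuous_turnOperator A.turnOperator_mono A.turnOperator_smul hε
  choose f hf hfeq using fun d =>
    Finset.exists_mem_eq_inf' (A.despotActions_nonempty d) (A.despotWeight (A.tribuneBest u) d)
  choose g hg hgeq using fun t =>
    Finset.exists_mem_eq_sup' (A.tribuneActions_nonempty t) (A.tribuneWeight u t)
  have hlow : ∀ d a, A.DespotLegal d a →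
      l * u d ≤ A.despotWeight (fun t => A.tribuneWeight u t (g t)) d a + ε := by
    intro d a ha
    rw [← heq d]
    have hbest : A.tribuneBest u = fun t => A.tribuneWeight u t (g t) := funext hgeq
    rw [← hbest]
    gcongr
    exact Finset.inf'_le _ (by simpa [Arena.despotActions] using ha)
  refine ⟨l, u, f, g, ⟨hl, ?_⟩, hu, hsum, fun d => by simpa [Arena.despotActions] using hf d,
    fun t => by simpa [Arena.tribuneActions] using hg t, fun d b hb => ?_, hlow⟩
  -- The bound on `l` is read off at a state `d` of largest weight: `u d` is at least `1 / card D`,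
  -- so `ε` is at most `ε * card D * u d`, and `u d` cancels.
  · obtain ⟨d, hd⟩ := Finite.exists_max u
    obtain ⟨a, ha⟩ := A.despot_nonblocking d
    have h1 : ∀ t b, A.tribuneWeight u t b ≤ Fintype.card D * u d := by
      intro t b
      classical
      calc _ ≤ ∑ e, u e := Finset.sum_le_sum_of_subset_of_nonneg (Finset.filter_subset _ _)
            fun e _ _ => (hu e).le
        _ ≤ ∑ _e : D, u d := Finset.sum_le_sum fun e _ => hd e
        _ = _ := by simp
    have hdpos : 0 ≤ Fintype.card D * u d := mul_nonneg (Nat.cast_nonneg _) (hu d).le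
    have h2 : A.despotWeight (fun t => A.tribuneWeight u t (g t)) d a ≤
        Fintype.card T * (Fintype.card D * u d) := by
      classical
      calc _ ≤ A.despotWeight (fun _ => Fintype.card D * u d) d a :=
            A.despotWeight_mono (fun t => h1 t _) d a
        _ ≤ ∑ _t : T, Fintype.card D * u d :=
            Finset.sum_le_sum_of_subset_of_nonneg (Finset.filter_subset _ _) fun _ _ _ => hdpos
        _ = _ := by simp
    have h3 : 1 ≤ Fintype.card D * u d := by
      rw [← hsum]
      calc _ ≤ ∑ _e : D, u d := Finset.sum_le_sum fun e _ => hd e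
        _ = _ := by simp
    refine le_of_mul_le_mul_right ?_ (hu d)
    have h4 := hlow d a ha
    have h5 := mul_le_mul_of_nonneg_left h3 hε.le
    linarith
  · rw [← heq d]
    have h1 : A.despotWeight (fun t => A.tribuneWeight u t (b t)) d (f d) ≤ A.turnOperator u d := by
      rw [Arena.turnOperator, hfeq d]
      refine A.despotWeight_mono (fun t => ?_) d _
      exact Finset.le_sup' _ (by simpa [Arena.tribuneActions] using hb t)
    linarith

end Operator

/-! ### Weighted counting of reachable positions -/

section Counting

variable {D T Act : Type*} {A : Arena D T Act} (σ : DespotStrategy A) (τ : TribuneStrategy A)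

/-- The turn played after the history `p.1` in the state `p.2`, if People move to `t`. -/
def nextTurn (p : List (Turn D T Act) × D) (t : T) : Turn D T Act :=
  ⟨p.2, σ.act p.1 p.2, t, τ.act p.1 p.2 (σ.act p.1 p.2) t⟩

/-- The position reached when People move to `m.1` and then to `m.2`. -/
def nextPosition (p : List (Turn D T Act) × D) (m : T × D) : List (Turn D T Act) × D :=
  (p.1 ++ [nextTurn σ τ p m.1], m.2)

/-- The moves of People allowed in the position `p`. -/
def LegalMove (p : List (Turn D T Act) × D) (m : T × D) : Prop :=
  A.despotTrans p.2 (nextTurn σ τ p m.1).despotAction m.1 ∧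
    A.tribuneTrans m.1 (nextTurn σ τ p m.1).tribuneAction m.2

theorem exists_legalMove (p : List (Turn D T Act) × D) : ∃ m, LegalMove σ τ p m := by
  obtain ⟨t, ht⟩ := σ.legal p.1 p.2
  obtain ⟨d, hd⟩ := τ.legal p.1 p.2 (σ.act p.1 p.2) t
  exact ⟨(t, d), ht, hd⟩

/-- The new position records the previous history, the previous state and both moves of People, so
the weight sum over one more turn counts nothing twice. -/
theorem nextPosition_injective :
    Function.Injective fun q : (List (Turn D T Act) × D) × (T × D) => nextPosition σ τ q.1 q.2 := by
  rintro ⟨⟨w, d⟩, t, e⟩ ⟨⟨w', d'⟩, t', e'⟩ h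
  simp only [nextPosition, Prod.mk.injEq] at h
  obtain ⟨h1, rfl⟩ := h
  obtain ⟨rfl, h2⟩ := List.append_inj' h1 rfl
  simp only [nextTurn, List.cons.injEq, Turn.mk.injEq] at h2
  obtain ⟨⟨rfl, -, rfl, -⟩, -⟩ := h2
  rfl

theorem initialTurns_succ (π : ℕ → Turn D T Act) (n : ℕ) :
    initialTurns π (n + 1) = initialTurns π n ++ [π n] := by
  simp [initialTurns, List.range_succ]

variable [Fintype D] [Fintype T]

open Classical in
/-- The positions (history and current state of Despot) reachable in `n` turns. -/
noncomputable def positions : ℕ → Finset (List (Turn D T Act) × D)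
  | 0 => univ.image fun d => ([], d)
  | n + 1 => ((positions n ×ˢ univ).filter fun q => LegalMove σ τ q.1 q.2).image
      fun q => nextPosition σ τ q.1 q.2

variable {σ τ} in
theorem mem_positions_succ {n : ℕ} {q : List (Turn D T Act) × D} :
    q ∈ positions σ τ (n + 1) ↔
      ∃ p ∈ positions σ τ n, ∃ m, LegalMove σ τ p m ∧ nextPosition σ τ p m = q := by
  simp only [positions, mem_image, mem_filter, mem_product, mem_univ, and_true]
  constructor
  · rintro ⟨⟨p, m⟩, ⟨hp, hm⟩, rfl⟩
    exact ⟨p, hp, m, hm, rfl⟩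
  · rintro ⟨p, hp, m, hm, rfl⟩
    exact ⟨(p, m), ⟨hp, hm⟩, rfl⟩

/-- The total weight of the positions reachable in one more turn. -/
theorem sum_positions_succ (u : D → ℝ) (n : ℕ) :
    ∑ q ∈ positions σ τ (n + 1), u q.2 = ∑ p ∈ positions σ τ n,
      A.despotWeight (fun t => A.tribuneWeight u t (τ.act p.1 p.2 (σ.act p.1 p.2) t)) p.2
        (σ.act p.1 p.2) := by
  classical
  rw [positions, Finset.sum_image (nextPosition_injective σ τ).injOn, Finset.sum_filter,
    Finset.sum_product]
  refine Finset.sum_congr rfl fun p _ => ?_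
  rw [← Finset.univ_product_univ, Finset.sum_product, Arena.despotWeight, Finset.sum_filter]
  refine Finset.sum_congr rfl fun t _ => ?_
  by_cases h : A.despotTrans p.2 (σ.act p.1 p.2) t
  · simp [h, Arena.tribuneWeight, Finset.sum_filter, LegalMove, nextTurn, nextPosition]
  · simp [h, LegalMove, nextTurn]

theorem sum_positions_zero (u : D → ℝ) : ∑ q ∈ positions σ τ 0, u q.2 = ∑ d, u d := by
  classical
  rw [positions, Finset.sum_image fun _ _ _ _ h => congrArg Prod.snd h]

variable {σ τ}

theorem mem_positions_of_mem_playLanguage {π : ℕ → Turn D T Act} (hπ : π ∈ playLanguage σ τ)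
    (n : ℕ) : (initialTurns π n, (π n).despotState) ∈ positions σ τ n := by
  obtain ⟨hplay, hσ, hτ⟩ := hπ
  induction n with
  | zero => simp [positions, initialTurns]
  | succ n ih =>
    have hturn : nextTurn σ τ (initialTurns π n, (π n).despotState) (π n).tribuneState = π n := by
      ext
      · rfl
      · exact (hσ n).symm
      · rfl
      · simp only [nextTurn]
        rw [hτ n, hσ n]
    refine mem_positions_succ.2 ⟨_, ih, ((π n).tribuneState, (π (n + 1)).despotState), ?_, ?_⟩
    · simp only [LegalMove, hturn]
      exact hplay n
    · simp only [nextPosition, hturn, initialTurns_succ]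

/-- Every reachable position lies on an infinite sequence of positions. -/
theorem exists_position_sequence {n : ℕ} {q : List (Turn D T Act) × D}
    (hq : q ∈ positions σ τ n) :
    ∃ s : ℕ → List (Turn D T Act) × D, (s 0).1 = [] ∧ s n = q ∧
      ∀ k, ∃ m, LegalMove σ τ (s k) m ∧ nextPosition σ τ (s k) m = s (k + 1) := by
  choose move hmove using exists_legalMove σ τ
  let next p := nextPosition σ τ p (move p)
  induction n generalizing q with
  | zero =>
    refine ⟨fun k => next^[k] q, ?_, rfl, fun k => ⟨_, hmove _, ?_⟩⟩
    · classical
      obtain ⟨d, -, rfl⟩ := Finset.mem_image.1 hq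
      rfl
    · beta_reduce
      rw [Function.iterate_succ_apply']
  | succ n ih =>
    obtain ⟨p, hp, m, hm, rfl⟩ := mem_positions_succ.1 hq
    obtain ⟨s, hs0, hsn, hs⟩ := ih hp
    -- Follow the sequence leading to `p`, then make the move `m`, then continue by arbitrary legal
    -- moves.
    refine ⟨fun k => if k ≤ n then s k else next^[k - (n + 1)] (nextPosition σ τ p m),
      by simpa using hs0, by simp, fun k => ?_⟩
    rcases lt_trichotomy k n with hk | rfl | hk
    · simpa only [if_pos hk.le, if_pos (Nat.succ_le_of_lt hk)] using hs k
    · exact ⟨m, by simpa [hsn] using hm, by simp [hsn]⟩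
    · refine ⟨_, hmove _, ?_⟩
      simp only [if_neg (not_le.2 hk), if_neg (not_le.2 (hk.trans (Nat.lt_succ_self k)))]
      rw [show k + 1 - (n + 1) = (k - (n + 1)) + 1 by omega, Function.iterate_succ_apply']

theorem exists_mem_playLanguage_of_mem_positions {n : ℕ} {q : List (Turn D T Act) × D}
    (hq : q ∈ positions σ τ n) : ∃ π ∈ playLanguage σ τ, initialTurns π n = q.1 := by
  obtain ⟨s, hs0, rfl, hs⟩ := exists_position_sequence hq
  choose m hm hnext using hs
  let π : ℕ → Turn D T Act := fun k => nextTurn σ τ (s k) (m k).1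
  have hinit : ∀ k, initialTurns π k = (s k).1 := by
    intro k
    induction k with
    | zero => simp [initialTurns, hs0]
    | succ k ih => rw [initialTurns_succ, ih, ← hnext k]; rfl
  refine ⟨π, ⟨fun k => ⟨(hm k).1, ?_⟩, fun k => ?_, fun k => ?_⟩, hinit n⟩
  · have h : (π (k + 1)).despotState = (m k).2 := by
      simp only [π, nextTurn, ← hnext k, nextPosition]
    rw [h]
    exact (hm k).2
  · rw [hinit]; rfl
  · rw [hinit]; rfl

-- Legal strategies never block, so prefixes of infinite plays are exactly the histories of
-- reachable positions. Forgetting the current state costs at most a factor `card D`.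
open Classical in
theorem turnPrefixes_eq_image (n : ℕ) :
    turnPrefixes (playLanguage σ τ) n = ((positions σ τ n).image Prod.fst : Finset _) := by
  ext w
  simp only [turnPrefixes, Set.mem_image, coe_image, mem_coe]
  constructor
  · rintro ⟨π, hπ, rfl⟩
    exact ⟨_, mem_positions_of_mem_playLanguage hπ n, rfl⟩
  · rintro ⟨q, hq, rfl⟩
    exact exists_mem_playLanguage_of_mem_positions hq

theorem ncard_turnPrefixes_le (n : ℕ) :
    (turnPrefixes (playLanguage σ τ) n).ncard ≤ #(positions σ τ n) := by
  classical
  rw [turnPrefixes_eq_image, Set.ncard_coe_finset]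
  exact Finset.card_image_le

theorem card_positions_le (n : ℕ) :
    #(positions σ τ n) ≤ (turnPrefixes (playLanguage σ τ) n).ncard * Fintype.card D := by
  classical
  rw [turnPrefixes_eq_image, Set.ncard_coe_finset, ← Finset.card_univ, ← Finset.card_product]
  exact Finset.card_le_card fun q hq =>
    Finset.mem_product.2 ⟨Finset.mem_image_of_mem _ hq, mem_univ _⟩

theorem sum_positions_le {u : D → ℝ} {l : ℝ} (hl : 0 ≤ l) (h : ∀ w d,
    A.despotWeight (fun t => A.tribuneWeight u t (τ.act w d (σ.act w d) t)) d (σ.act w d) ≤ l * u d)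
    (n : ℕ) : ∑ q ∈ positions σ τ n, u q.2 ≤ l ^ n * ∑ d, u d := by
  induction n with
  | zero => simp [sum_positions_zero]
  | succ n ih =>
    rw [sum_positions_succ]
    calc _ ≤ ∑ p ∈ positions σ τ n, l * u p.2 := Finset.sum_le_sum fun p _ => h p.1 p.2
      _ = l * ∑ p ∈ positions σ τ n, u p.2 := by rw [Finset.mul_sum]
      _ ≤ l * (l ^ n * ∑ d, u d) := mul_le_mul_of_nonneg_left ih hl
      _ = _ := by ring

theorem le_sum_positions {u : D → ℝ} {l : ℝ} (hl : 0 ≤ l) (h : ∀ w d, l * u d ≤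
    A.despotWeight (fun t => A.tribuneWeight u t (τ.act w d (σ.act w d) t)) d (σ.act w d))
    (n : ℕ) : l ^ n * ∑ d, u d ≤ ∑ q ∈ positions σ τ n, u q.2 := by
  induction n with
  | zero => simp [sum_positions_zero]
  | succ n ih =>
    rw [sum_positions_succ]
    calc l ^ (n + 1) * ∑ d, u d = l * (l ^ n * ∑ d, u d) := by ring
      _ ≤ l * ∑ p ∈ positions σ τ n, u p.2 := mul_le_mul_of_nonneg_left ih hl
      _ = ∑ p ∈ positions σ τ n, l * u p.2 := by rw [Finset.mul_sum]
      _ ≤ _ := Finset.sum_le_sum fun p _ => h p.1 p.2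

end Counting

/-! ### From weight bounds to growth rates -/

section Payoff

theorem tendsto_ofReal_mul_pow_rpow {C l : ℝ} (hC : 0 < C) (hl : 0 ≤ l) :
    Tendsto (fun n : ℕ => ENNReal.ofReal (C * l ^ n) ^ (1 / (n : ℝ))) atTop
      (𝓝 (ENNReal.ofReal l)) := by
  have h0 : Tendsto (fun n : ℕ => C ^ (1 / (n : ℝ)) * l) atTop (𝓝 l) := by
    have h : Tendsto (fun n : ℕ => C ^ (1 / (n : ℝ))) atTop (𝓝 (C ^ (0 : ℝ))) :=
      (Real.continuousAt_const_rpow hC.ne').tendsto.comp tendsto_one_div_atTop_nhds_zero_nat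
    simpa using h.mul_const l
  refine (ENNReal.tendsto_ofReal h0).congr' ?_
  filter_upwards [eventually_ne_atTop 0] with n hn
  rw [ENNReal.ofReal_rpow_of_nonneg (by positivity) (by positivity),
    Real.mul_rpow hC.le (by positivity), one_div, Real.pow_rpow_inv_natCast hl hn]

variable {D T Act : Type*} {A : Arena D T Act} {σ : DespotStrategy A} {τ : TribuneStrategy A}

theorem payoff_eq_zero_of_isEmpty [IsEmpty D] : payoff σ τ = 0 := by
  have hempty : playLanguage σ τ = ∅ :=
    Set.eq_empty_of_forall_notMem fun π _ => isEmptyElim (π 0).despotState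
  refine Tendsto.limsup_eq (tendsto_const_nhds.congr' ?_)
  -- At `n = 0` the exponent is `1 / 0 = 0` and the term is `1`, so the equality holds only
  -- eventually.
  filter_upwards [eventually_gt_atTop 0] with n hn
  have hn' : (0 : ℝ) < 1 / n := by positivity
  simp only [hempty, turnPrefixes, Set.image_empty, Set.ncard_empty, Nat.cast_zero]
  rw [ENNReal.zero_rpow_of_pos hn']

theorem Arena.isDeterminedWithValue_of_guarantees {V : ℝ≥0∞} (hσ : σ.Guarantees V)
    (hτ : τ.Guarantees V) : A.IsDeterminedWithValue V := by
  have h1 : (⨅ σ : DespotStrategy A, ⨆ τ : TribuneStrategy A, payoff σ τ) ≤ V :=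
    iInf_le_of_le σ (iSup_le hσ)
  have h2 : V ≤ ⨆ τ : TribuneStrategy A, ⨅ σ : DespotStrategy A, payoff σ τ :=
    le_iSup_of_le τ (le_iInf hτ)
  have h3 : (⨆ τ : TribuneStrategy A, ⨅ σ : DespotStrategy A, payoff σ τ) ≤
      ⨅ σ : DespotStrategy A, ⨆ τ : TribuneStrategy A, payoff σ τ := iSup_iInf_le_iInf_iSup _
  exact ⟨le_antisymm h1 (h2.trans h3), le_antisymm (h3.trans h1) h2⟩

variable [Fintype D] [Fintype T]

/-- Each position weighs at least `min u > 0`, so there are at most `l ^ n / min u` of them; the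
constant disappears under the `n`-th root. -/
theorem payoff_le_of_weight [Nonempty D] {u : D → ℝ} {l : ℝ} (hl : 0 ≤ l) (hu : ∀ d, 0 < u d)
    (hsum : ∑ d, u d = 1) (h : ∀ w d,
      A.despotWeight (fun t => A.tribuneWeight u t (τ.act w d (σ.act w d) t)) d (σ.act w d) ≤
        l * u d) :
    payoff σ τ ≤ ENNReal.ofReal l := by
  obtain ⟨e, he⟩ := Finite.exists_min u
  refine le_trans (limsup_le_limsup (Eventually.of_forall fun n => ?_))
    (tendsto_ofReal_mul_pow_rpow (inv_pos.2 (hu e)) hl).limsup_eq.le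
  refine ENNReal.rpow_le_rpow ?_ (by positivity)
  rw [← ENNReal.ofReal_natCast]
  refine ENNReal.ofReal_le_ofReal ?_
  rw [inv_mul_eq_div, le_div_iff₀ (hu e)]
  calc _ ≤ (#(positions σ τ n) : ℝ) * u e :=
        mul_le_mul_of_nonneg_right (by exact_mod_cast ncard_turnPrefixes_le n) (hu e).le
    _ = ∑ _q ∈ positions σ τ n, u e := by simp
    _ ≤ ∑ q ∈ positions σ τ n, u q.2 := Finset.sum_le_sum fun q _ => he q.2
    _ ≤ l ^ n * ∑ d, u d := sum_positions_le hl h n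
    _ = l ^ n := by rw [hsum, mul_one]

/-- Each position weighs at most `1`, so there are at least `l ^ n` of them. Zero weights are
harmless here, which allows a limit of positive weights. -/
theorem le_payoff_of_weight [Nonempty D] {u : D → ℝ} {l : ℝ} (hl : 0 ≤ l) (hu : ∀ d, 0 ≤ u d)
    (hsum : ∑ d, u d = 1) (h : ∀ w d, l * u d ≤
      A.despotWeight (fun t => A.tribuneWeight u t (τ.act w d (σ.act w d) t)) d (σ.act w d)) :
    ENNReal.ofReal l ≤ payoff σ τ := by
  have hD : (0 : ℝ) < Fintype.card D := by exact_mod_cast Fintype.card_pos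
  refine le_trans (tendsto_ofReal_mul_pow_rpow (inv_pos.2 hD) hl).limsup_eq.ge
    (limsup_le_limsup (Eventually.of_forall fun n => ?_))
  refine ENNReal.rpow_le_rpow ?_ (by positivity)
  rw [← ENNReal.ofReal_natCast]
  refine ENNReal.ofReal_le_ofReal ?_
  rw [inv_mul_eq_div, div_le_iff₀ hD]
  calc l ^ n = l ^ n * ∑ d, u d := by rw [hsum, mul_one]
    _ ≤ ∑ q ∈ positions σ τ n, u q.2 := le_sum_positions hl h n
    _ ≤ ∑ _q ∈ positions σ τ n, (1 : ℝ) := Finset.sum_le_sum fun q _ => by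
        rw [← hsum]; exact Finset.single_le_sum (fun d _ => hu d) (mem_univ q.2)
    _ = #(positions σ τ n) := by simp
    _ ≤ _ := by exact_mod_cast card_positions_le n

end Payoff

/-! ### Positional strategies and the limit of vanishing perturbation -/

section Positional

variable {D T Act : Type*} {A : Arena D T Act}

/-- The strategy of Despot which plays `f d` in state `d`. -/
def DespotStrategy.ofFun (f : D → Act) (hf : ∀ d, A.DespotLegal d (f d)) : DespotStrategy A where
  act _ d := f d
  legal _ d := hf d

/-- The strategy of Tribune which plays `g t` in state `t`. -/
def TribuneStrategy.ofFun (g : T → Act) (hg : ∀ t, A.TribuneLegal t (g t)) :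
    TribuneStrategy A where
  act _ _ _ t := g t
  legal _ _ _ t := hg t

theorem DespotStrategy.isPositional_ofFun (f : D → Act) (hf : ∀ d, A.DespotLegal d (f d)) :
    (DespotStrategy.ofFun f hf).IsPositional := ⟨f, fun _ _ => rfl⟩

theorem TribuneStrategy.isPositional_ofFun (g : T → Act) (hg : ∀ t, A.TribuneLegal t (g t)) :
    (TribuneStrategy.ofFun g hg).IsPositional := ⟨g, fun _ _ _ _ => rfl⟩

theorem exists_positional_guarantees [Fintype D] [Fintype T] [Fintype Act] [Nonempty D]
    (A : Arena D T Act) :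
    ∃ V : ℝ≥0, (∃ σ : DespotStrategy A, σ.IsPositional ∧ σ.Guarantees V) ∧
      ∃ τ : TribuneStrategy A, τ.IsPositional ∧ τ.Guarantees V := by
  choose l u f g hl hu hsum hf hg hup hlow using fun k : ℕ =>
    A.exists_approx_equilibrium (ε := 1 / ((k : ℝ) + 1)) (by positivity)
  -- There are finitely many pairs of positional choices, so one of them serves for infinitely many
  -- perturbations.
  obtain ⟨⟨f₀, g₀⟩, hfreq⟩ : ∃ p : (D → Act) × (T → Act), ∃ᶠ k in atTop, (f k, g k) = p := by
    obtain ⟨p, hp⟩ := Finite.exists_infinite_fiber fun k => (f k, g k)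
    exact ⟨p, Nat.frequently_atTop_iff_infinite.2 (Set.infinite_coe_iff.1 hp)⟩
  obtain ⟨φ, hφ, hφp⟩ := extraction_of_frequently_atTop hfreq
  have hcomp : IsCompact (Set.Icc (0 : ℝ) (Fintype.card T * Fintype.card D + Fintype.card D) ×ˢ
      stdSimplex ℝ D) := isCompact_Icc.prod (isCompact_stdSimplex ℝ D)
  obtain ⟨⟨V, v⟩, ⟨⟨hV0, -⟩, hv⟩, ψ, hψ, hlim⟩ :=
    hcomp.tendsto_subseq (x := fun k => (l (φ k), u (φ k))) fun k => by
      refine ⟨⟨(hl _).1, (hl _).2.trans ?_⟩, fun d => (hu _ d).le, hsum _⟩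
      gcongr
      refine mul_le_of_le_one_left (Nat.cast_nonneg _) ?_
      rw [div_le_one (by positivity)]
      simp
  have hfeq : ∀ k, f (φ (ψ k)) = f₀ := fun k => congrArg Prod.fst (hφp _)
  have hgeq : ∀ k, g (φ (ψ k)) = g₀ := fun k => congrArg Prod.snd (hφp _)
  have hlimV : Tendsto (fun k => l (φ (ψ k))) atTop (𝓝 V) :=
    (continuous_fst.tendsto _).comp hlim
  have hlimv : Tendsto (fun k => u (φ (ψ k))) atTop (𝓝 v) :=
    (continuous_snd.tendsto _).comp hlim
  have hf₀ : ∀ d, A.DespotLegal d (f₀ d) := hfeq 0 ▸ hf _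
  have hg₀ : ∀ t, A.TribuneLegal t (g₀ t) := hgeq 0 ▸ hg _
  have hvlow : ∀ d a, A.DespotLegal d a →
      V * v d ≤ A.despotWeight (fun t => A.tribuneWeight v t (g₀ t)) d a := by
    intro d a ha
    have hcont : Continuous fun x : D → ℝ =>
        A.despotWeight (fun t => A.tribuneWeight x t (g₀ t)) d a := by
      unfold Arena.despotWeight Arena.tribuneWeight
      fun_prop
    have hε : Tendsto (fun k => 1 / (((φ (ψ k) : ℕ) : ℝ) + 1)) atTop (𝓝 0) :=
      tendsto_one_div_add_atTop_nhds_zero_nat.comp (hφ.comp hψ).tendsto_atTop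
    have h1 := hlimV.mul ((continuous_apply d).tendsto _ |>.comp hlimv)
    have h2 := ((hcont.tendsto _).comp hlimv).add hε
    rw [add_zero] at h2
    refine le_of_tendsto_of_tendsto' h1 h2 fun k => ?_
    simpa only [Function.comp_apply, hgeq] using hlow (φ (ψ k)) d a ha
  refine ⟨V.toNNReal, ⟨DespotStrategy.ofFun f₀ hf₀, DespotStrategy.isPositional_ofFun _ _,
    fun τ => ?_⟩, ⟨TribuneStrategy.ofFun g₀ hg₀, TribuneStrategy.isPositional_ofFun _ _,
    fun σ => ?_⟩⟩
  -- `v` may vanish, so the limit is taken after the payoff bound: the same `f₀` guarantees every `l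
  -- (φ (ψ k))`, hence also `V`.
  · refine ge_of_tendsto' (ENNReal.tendsto_ofReal hlimV) fun k => ?_
    refine payoff_le_of_weight (hl _).1 (hu (φ (ψ k))) (hsum _) fun w d => ?_
    have h := hup (φ (ψ k)) d (fun t => τ.act w d (f₀ d) t) fun t => τ.legal w d (f₀ d) t
    rwa [hfeq] at h
  · exact le_payoff_of_weight hV0 hv.1 hv.2 fun w d => hvlow d _ (σ.legal w d)

end Positional

end EntropyGame

/-- Every entropy game on a finite arena is determined, with a finite value, and both players have
positional optimal strategies, i.e. positional strategies guaranteeing the value. -/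
theorem mainTheorem3 {D T Act : Type*} [Finite D] [Finite T] [Finite Act]
    (A : EntropyGame.Arena D T Act) :
    ∃ V : ℝ≥0, A.IsDeterminedWithValue (V : ℝ≥0∞) ∧
      (∃ σ : EntropyGame.DespotStrategy A, σ.IsPositional ∧ σ.Guarantees (V : ℝ≥0∞)) ∧
      (∃ τ : EntropyGame.TribuneStrategy A, τ.IsPositional ∧ τ.Guarantees (V : ℝ≥0∞)) := by
  suffices h : ∃ V : ℝ≥0,
      (∃ σ : EntropyGame.DespotStrategy A, σ.IsPositional ∧ σ.Guarantees (V : ℝ≥0∞)) ∧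
      (∃ τ : EntropyGame.TribuneStrategy A, τ.IsPositional ∧ τ.Guarantees (V : ℝ≥0∞)) by
    obtain ⟨V, ⟨σ, hσ, hσV⟩, τ, hτ, hτV⟩ := h
    exact ⟨V, EntropyGame.Arena.isDeterminedWithValue_of_guarantees hσV hτV, ⟨σ, hσ, hσV⟩,
      τ, hτ, hτV⟩
  rcases isEmpty_or_nonempty D with hD | hD
  -- Without initial states there are no plays and every payoff is `0`.
  · choose f hf using A.despot_nonblocking
    choose g hg using A.tribune_nonblocking
    exact ⟨0, ⟨_, EntropyGame.DespotStrategy.isPositional_ofFun f hf, fun τ =>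
        EntropyGame.payoff_eq_zero_of_isEmpty.le⟩,
      ⟨_, EntropyGame.TribuneStrategy.isPositional_ofFun g hg, fun σ => zero_le⟩⟩
  · have := Fintype.ofFinite D
    have := Fintype.ofFinite T
    have := Fintype.ofFinite Act
    exact EntropyGame.exists_positional_guarantees A
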